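/- Let $I_\nu(z)=\sum_{k\ge 0}\frac{1}{k!\,(k+\nu)!}\left(\frac z2\right)^{2k+\nu}$ denote the modified Bessel function of the first kind. The function $x\left(\frac{\sqrt{x}\,I_0(2\sqrt{x})}{I_1(2\sqrt{x})}-2\right)$, which extends analytically to a neighbourhood of $x=0$ with value $0$ there, has near $x=0$ a convergent power series expansion $$x\left(\frac{\sqrt{x}\,I_0(2\sqrt{x})}{I_1(2\sqrt{x})}-2\right)=\sum_{k=1}^{\infty}a_k x^k .$$ Define $M_k=(-1)^{k+1}(k+1)!\,k!\,a_{k+1}$ for $k\ge 0$. Then every $M_k$ is an integer. -/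

import Mathlib

open Filter Topology
open scoped Nat

noncomputable section

/-- The modified Bessel function of the first kind of order `ν : ℕ`,
`I_ν(z) = ∑_{k ≥ 0} (z / 2)^(2k + ν) / (k! (k + ν)!)`. The series converges for every `z`. -/
def besselI (ν : ℕ) (z : ℂ) : ℂ :=
  ∑' k : ℕ, 1 / ((k ! : ℂ) * ((k + ν)! : ℂ)) * (z / 2) ^ (2 * k + ν)

/-- The principal square root. Any other branch gives the same `besselGen` below, because
`w ↦ w * I_0(2w) / I_1(2w)` is even. -/
def csqrt (x : ℂ) : ℂ := x ^ (1 / 2 : ℂ)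

/-- The generating function `x (√x I_0(2√x) / I_1(2√x) - 2)`. At the removable singularity
`x = 0` the formula has the value `0`, which is also the limit there. -/
def besselGen (x : ℂ) : ℂ :=
  x * (csqrt x * besselI 0 (2 * csqrt x) / besselI 1 (2 * csqrt x) - 2)

/-- The coefficient `a_k` of `x^k` in the power series of `besselGen` at `0`. -/
def besselCoeff (k : ℕ) : ℂ := iteratedDeriv k besselGen 0 / (k ! : ℂ)

/-- `M_k = (-1)^(k+1) (k+1)! k! a_{k+1}`. -/
def besselM (k : ℕ) : ℂ :=
  (-1) ^ (k + 1) * ((k + 1)! : ℂ) * (k ! : ℂ) * besselCoeff (k + 1)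

end

/-! Put F_ν(x) = ∑ x^k / (k! (k+ν)!). The square roots cancel, so the generating function is x
(F_0/F_1 - 2). Let q_k be the Taylor coefficients of F_0/F_1 and Q_k = k! (k+1)! q_k. Multiplying
the x^k coefficient of (F_0/F_1) F_1 = F_0 by k! (k+1)! gives ∑_{i ≤ k} N(i, k-i) Q_i = k + 1, where
N(i, j) is the Narayana number of `exists_int_narayana`. Since N(k, 0) = 1, strong induction makes
every Q_k an integer; M_k is ±Q_k, up to an integer correction at k = 0. -/

theorem hasFPowerSeriesAt_ofScalars {c : ℕ → ℂ} {f : ℂ → ℂ}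
    (h : ∀ᶠ x in 𝓝 (0 : ℂ), HasSum (fun n => c n * x ^ n) (f x)) :
    HasFPowerSeriesAt f (FormalMultilinearSeries.ofScalars ℂ c) 0 := by
  rw [hasFPowerSeriesAt_iff]
  filter_upwards [h] with x hx
  simpa [FormalMultilinearSeries.coeff_ofScalars, mul_comm] using hx

/-- The Taylor coefficients at `0` of the sum of a convergent power series. -/
theorem iteratedDeriv_div_factorial_of_hasSum {c : ℕ → ℂ} {f : ℂ → ℂ}
    (h : ∀ᶠ x in 𝓝 (0 : ℂ), HasSum (fun n => c n * x ^ n) (f x)) (n : ℕ) :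
    iteratedDeriv n f 0 / (n ! : ℂ) = c n := by
  have h1 := hasFPowerSeriesAt_ofScalars h
  have h2 := h1.eq_formalMultilinearSeries h1.analyticAt.hasFPowerSeriesAt
  have h3 := congrArg (fun p => FormalMultilinearSeries.coeff p n) h2
  simpa [FormalMultilinearSeries.coeff_ofScalars] using h3.symm

theorem analyticAt_zero_of_hasSum {c : ℕ → ℂ} {f : ℂ → ℂ}
    (h : ∀ᶠ x in 𝓝 (0 : ℂ), HasSum (fun n => c n * x ^ n) (f x)) : AnalyticAt ℂ f 0 :=
  (hasFPowerSeriesAt_ofScalars h).analyticAt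

theorem AnalyticAt.eventually_hasSum_zero {f : ℂ → ℂ} (h : AnalyticAt ℂ f 0) :
    ∀ᶠ x in 𝓝 (0 : ℂ), HasSum (fun n => iteratedDeriv n f 0 / (n ! : ℂ) * x ^ n) (f x) := by
  have h1 := hasFPowerSeriesAt_iff.1 h.hasFPowerSeriesAt
  filter_upwards [h1] with x hx
  simpa [FormalMultilinearSeries.coeff_ofScalars, mul_comm] using hx

/-- The Cauchy product of two convergent power series. -/
theorem HasSum.cauchyProduct {a b : ℕ → ℂ} {x s t : ℂ}
    (ha : HasSum (fun n => a n * x ^ n) s) (hb : HasSum (fun n => b n * x ^ n) t) :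
    HasSum (fun n => (∑ p ∈ Finset.HasAntidiagonal.antidiagonal n, a p.1 * b p.2) * x ^ n) (s * t) := by
  have h1 := summable_norm_sum_mul_antidiagonal_of_summable_norm ha.summable.norm hb.summable.norm
  have h2 := tsum_mul_tsum_eq_tsum_sum_antidiagonal_of_summable_norm
    ha.summable.norm hb.summable.norm
  rw [ha.tsum_eq, hb.tsum_eq] at h2
  rw [h2]
  refine h1.of_norm.hasSum.congr_fun fun n => ?_
  rw [Finset.sum_mul]
  refine Finset.sum_congr rfl fun p hp => ?_
  rw [← Finset.HasAntidiagonal.mem_antidiagonal.1 hp, pow_add]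
  ring

/-- The series `∑ x ^ k / (k! (k + ν)!)`, an entire function of `x`. -/
noncomputable def besselClifford (ν : ℕ) (x : ℂ) : ℂ := ∑' k : ℕ, 1 / ((k ! : ℂ) * ((k + ν)! : ℂ)) * x ^ k

theorem hasSum_besselClifford (ν : ℕ) (x : ℂ) :
    HasSum (fun k : ℕ => 1 / ((k ! : ℂ) * ((k + ν)! : ℂ)) * x ^ k) (besselClifford ν x) := by
  refine Summable.hasSum (Summable.of_norm_bounded (Real.summable_pow_div_factorial ‖x‖) fun k => ?_)
  have h1 : (1 : ℝ) ≤ ((k + ν)! : ℝ) := by exact_mod_cast Nat.factorial_pos _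
  have h2 : (0 : ℝ) < (k ! : ℝ) := by exact_mod_cast Nat.factorial_pos _
  simp only [norm_mul, norm_div, norm_one, norm_pow, Complex.norm_natCast]
  rw [one_div_mul_eq_div]
  gcongr
  exact le_mul_of_one_le_right h2.le h1

theorem besselI_two_mul (ν : ℕ) (z : ℂ) : besselI ν (2 * z) = z ^ ν * besselClifford ν (z ^ 2) := by
  rw [besselI, besselClifford, ← tsum_mul_left]
  refine tsum_congr fun k => ?_
  rw [mul_div_cancel_left₀ z two_ne_zero, pow_add, pow_mul]
  ring

theorem csqrt_sq (x : ℂ) : csqrt x ^ 2 = x := by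
  rw [csqrt, one_div]
  exact_mod_cast Complex.cpow_nat_inv_pow x two_ne_zero

theorem besselGen_eq (x : ℂ) :
    besselGen x = x * (besselClifford 0 x / besselClifford 1 x - 2) := by
  rcases eq_or_ne x 0 with rfl | hx
  · simp [besselGen]
  have h : csqrt x ≠ 0 := fun h => hx (by rw [← csqrt_sq x, h]; simp)
  rw [besselGen, besselI_two_mul, besselI_two_mul, csqrt_sq, pow_zero, one_mul, pow_one,
    mul_div_mul_left _ _ h]

theorem besselClifford_zero (ν : ℕ) : besselClifford ν 0 = 1 / (ν ! : ℂ) := by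
  rw [besselClifford, tsum_eq_single 0 fun k hk => by simp [hk]]
  simp

theorem analyticAt_besselClifford (ν : ℕ) : AnalyticAt ℂ (besselClifford ν) 0 :=
  analyticAt_zero_of_hasSum (Filter.Eventually.of_forall (hasSum_besselClifford ν))

/-- The Taylor coefficients at `0` of the quotient `√x I_0(2√x) / I_1(2√x)`. -/
noncomputable def besselQuotCoeff (k : ℕ) : ℂ :=
  iteratedDeriv k (fun x => besselClifford 0 x / besselClifford 1 x) 0 / (k ! : ℂ)

theorem eventually_hasSum_besselQuot : ∀ᶠ x in 𝓝 (0 : ℂ),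
    HasSum (fun k => besselQuotCoeff k * x ^ k) (besselClifford 0 x / besselClifford 1 x) :=
  AnalyticAt.eventually_hasSum_zero ((analyticAt_besselClifford 0).fun_div
    (analyticAt_besselClifford 1) (by simp [besselClifford_zero]))

/-- Uniqueness of Taylor coefficients applied to (F_0/F_1) F_1 = F_0, valid near 0 because F_1(0) =
1. -/
theorem sum_besselQuotCoeff (n : ℕ) :
    ∑ p ∈ Finset.HasAntidiagonal.antidiagonal n, besselQuotCoeff p.1 * (1 / ((p.2 ! : ℂ) * ((p.2 + 1)! : ℂ))) =
      1 / ((n ! : ℂ) * (n ! : ℂ)) := by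
  have h0 : ∀ᶠ x in 𝓝 (0 : ℂ), besselClifford 1 x ≠ 0 :=
    (analyticAt_besselClifford 1).continuousAt.eventually_ne (by simp [besselClifford_zero])
  have h1 : ∀ᶠ x in 𝓝 (0 : ℂ), HasSum (fun n => (∑ p ∈ Finset.HasAntidiagonal.antidiagonal n,
      besselQuotCoeff p.1 * (1 / ((p.2 ! : ℂ) * ((p.2 + 1)! : ℂ)))) * x ^ n)
      (besselClifford 0 x) := by
    filter_upwards [eventually_hasSum_besselQuot, h0] with x hx hx0
    have h2 := hx.cauchyProduct (hasSum_besselClifford 1 x)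
    rwa [div_mul_cancel₀ _ hx0] at h2
  rw [← iteratedDeriv_div_factorial_of_hasSum h1]
  exact iteratedDeriv_div_factorial_of_hasSum
    (Filter.Eventually.of_forall (hasSum_besselClifford 0)) n

/-- The Narayana numbers are integers. -/
theorem exists_int_narayana (i j : ℕ) : ∃ m : ℤ,
    (((i + j)! : ℂ) * ((i + j + 1)! : ℂ)) /
      ((i ! : ℂ) * ((i + 1)! : ℂ) * ((j ! : ℂ) * ((j + 1)! : ℂ))) = m := by
  -- With C = (i+j).choose i, the subtracted product is C² · ij / ((i+1)(j+1)), so the difference is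
  -- C² (i+j+1) / ((i+1)(j+1)).
  refine ⟨(i + j).choose i ^ 2 - (i + j).choose (i + 1) * (i + j).choose (j + 1), ?_⟩
  have h1 := Nat.choose_succ_right_eq (i + j) i
  have h2 := Nat.choose_succ_right_eq (i + j) j
  rw [Nat.add_sub_cancel_left] at h1
  rw [Nat.add_sub_cancel, ← Nat.choose_symm_add] at h2
  have h3 := Nat.add_choose_mul_factorial_mul_factorial i j
  rw [← Nat.choose_symm_add] at h3
  have hi : (i ! : ℂ) ≠ 0 := by exact_mod_cast i.factorial_ne_zero
  have hj : (j ! : ℂ) ≠ 0 := by exact_mod_cast j.factorial_ne_zero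
  have hi1 : (i : ℂ) + 1 ≠ 0 := by exact_mod_cast i.succ_ne_zero
  have hj1 : (j : ℂ) + 1 ≠ 0 := by exact_mod_cast j.succ_ne_zero
  replace h1 := congrArg (Nat.cast : ℕ → ℂ) h1
  replace h2 := congrArg (Nat.cast : ℕ → ℂ) h2
  replace h3 := congrArg (Nat.cast : ℕ → ℂ) h3
  push_cast at h1 h2 h3
  rw [← eq_div_iff hi1] at h1
  rw [← eq_div_iff hj1] at h2
  simp only [Nat.factorial_succ]
  push_cast
  rw [h1, h2, ← h3]
  field_simp
  ring

theorem exists_int_besselQuotCoeff (k : ℕ) :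
    ∃ m : ℤ, (k ! : ℂ) * ((k + 1)! : ℂ) * besselQuotCoeff k = m := by
  induction k using Nat.strong_induction_on with
  | _ k ih =>
  have hf (n : ℕ) : (n ! : ℂ) ≠ 0 := by exact_mod_cast n.factorial_ne_zero
  have h := congrArg (fun z => (k ! : ℂ) * ((k + 1)! : ℂ) * z) (sum_besselQuotCoeff k)
  simp only [Finset.Nat.sum_antidiagonal_eq_sum_range_succ_mk, Finset.sum_range_succ, mul_add,
    Finset.mul_sum] at h
  have hr : (k ! : ℂ) * ((k + 1)! : ℂ) * (1 / ((k ! : ℂ) * (k ! : ℂ))) = ((k + 1 : ℕ) : ℤ) := by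
    have := hf k
    rw [Nat.factorial_succ]
    push_cast
    field_simp
  have hs : ∃ m : ℤ, ∑ i ∈ Finset.range k, (k ! : ℂ) * ((k + 1)! : ℂ) *
      (besselQuotCoeff i * (1 / (((k - i)! : ℂ) * ((k - i + 1)! : ℂ)))) = m := by
    -- Membership sits under the existential so that `choose` yields a total function of `i`.
    have hi : ∀ i : ℕ, ∃ m : ℤ, i ∈ Finset.range k → (k ! : ℂ) * ((k + 1)! : ℂ) *
        (besselQuotCoeff i * (1 / (((k - i)! : ℂ) * ((k - i + 1)! : ℂ)))) = m := by
      intro i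
      by_cases hik : i < k
      · obtain ⟨m, hm⟩ := ih i hik
        obtain ⟨N, hN⟩ := exists_int_narayana i (k - i)
        rw [Nat.add_sub_cancel' hik.le] at hN
        refine ⟨N * m, fun _ => ?_⟩
        rw [Int.cast_mul, ← hm, ← hN]
        have h1 := hf i
        have h2 := hf (i + 1)
        have h3 := hf (k - i)
        have h4 := hf (k - i + 1)
        field_simp
      · exact ⟨0, fun h => absurd (Finset.mem_range.1 h) hik⟩
    choose g hg using hi
    exact ⟨∑ i ∈ Finset.range k, g i, by rw [Int.cast_sum]; exact Finset.sum_congr rfl hg⟩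
  obtain ⟨m, hm⟩ := hs
  rw [hm, hr] at h
  refine ⟨((k + 1 : ℕ) : ℤ) - m, ?_⟩
  -- What remains is the term i = k, whose factor 1 / (0! 1!) is 1.
  rw [Int.cast_sub, ← h]
  simp

theorem mainTheorem9 :
    (∀ᶠ x in 𝓝 (0 : ℂ),
      HasSum (fun k : ℕ => besselCoeff (k + 1) * x ^ (k + 1)) (besselGen x)) ∧
    ∀ k : ℕ, ∃ m : ℤ, besselM k = (m : ℂ) := by
  -- The constant -2 alters only the coefficient at 0; the outer factor x then shifts indices by
  -- one.
  set b : ℕ → ℂ := fun k => besselQuotCoeff k - if k = 0 then 2 else 0 with hb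
  have h1 : ∀ᶠ x in 𝓝 (0 : ℂ), HasSum (fun k : ℕ => b k * x ^ (k + 1)) (besselGen x) := by
    filter_upwards [eventually_hasSum_besselQuot] with x hx
    rw [besselGen_eq]
    have h2 : HasSum (fun k : ℕ => if k = 0 then (2 : ℂ) else 0) 2 := hasSum_ite_eq 0 2
    refine ((hx.sub h2).mul_left x).congr_fun fun k => ?_
    rcases eq_or_ne k 0 with rfl | hk
    · simp [hb, mul_comm]
    · simp [hb, hk, pow_succ]
      ring
  have h2 : ∀ᶠ x in 𝓝 (0 : ℂ),
      HasSum (fun k : ℕ => (if k = 0 then 0 else b (k - 1)) * x ^ k) (besselGen x) := by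
    filter_upwards [h1] with x hx
    rw [← hasSum_nat_add_iff' 1]
    simpa using hx
  have h3 (k : ℕ) : besselCoeff (k + 1) = b k :=
    iteratedDeriv_div_factorial_of_hasSum h2 (k + 1)
  refine ⟨by simpa only [h3] using h1, fun k => ?_⟩
  obtain ⟨m, hm⟩ := exists_int_besselQuotCoeff k
  refine ⟨(-1) ^ (k + 1) * (m - ((k)! * (k + 1)! : ℕ) * if k = 0 then 2 else 0), ?_⟩
  simp only [besselM, h3, hb]
  push_cast
  rw [← hm]
  ring
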